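/- **Theorem 3.** Let $t\ge 1$, let $\mathcal W_1,\dots,\mathcal W_t,\mathcal Y_1,\dots,\mathcal Y_t$ be finite alphabets, and let $(W_1,\dots,W_t,Y_1,\dots,Y_t)$ have joint pmf $q$ on $\mathcal W_1\times\cdots\times\mathcal W_t\times\mathcal Y_1\times\cdots\times\mathcal Y_t$. Put $X=(W_1,\dots,W_t)$ and $\mathcal X=\mathcal W_1\times\cdots\times\mathcal W_t$. For $n\ge1$, let $(X_i,Y_{1,i},\dots,Y_{t,i})_{i=1}^n$, with $X_i=(W_{1,i},\dots,W_{t,i})$, be iid according to $q$. A code of blocklength $n$ consists of finite sets $\mathcal M_1,\dots,\mathcal M_t$, an encoder $f:\mathcal X^n\to\mathcal M_1\times\cdots\times\mathcal M_t$, and decoders $g_l:\mathcal M_1\times\cdots\times\mathcal M_l\times\mathcal Y_l^n\to\mathcal W_l^n$ for $l=1,\dots,t$. With $(M_1,\dots,M_t)=f(X_1,\dots,X_n)$ and $\hat{\mathbf W}_l=g_l(M_1,\dots,M_l,Y_{l,1},\dots,Y_{l,n})$, its rates are $\kappa_l=\frac1n\log_2|\mathcal M_l|$ and its average symbol error probabilities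 are $P_e^l=\frac1n\sum_{i=1}^n\Pr[\hat W_{l,i}\ne W_{l,i}]$. Let $\mathcal R(0,\dots,0)$ be the set of all $\mathbf r\in\mathbb R_+^t$ such that for every $\epsilon>0$ there are an $n\ge1$ and a code of blocklength $n$ with $P_e^l\le\epsilon$ and $\kappa_l\le r_l+\epsilon$ for all $l=1,\dots,t$. If the side-information is degraded, i.e. $(W_1,\dots,W_t) - Y_t - Y_{t-1}-\cdots-Y_1$ is a Markov chain under $q$, then $$\mathcal R(0,\dots,0)=\Big\{\mathbf r\in\mathbb R_+^t:\ \sum_{k=1}^l r_k\ \ge\ \sum_{k=1}^l H(W_k\mid W_1,\dots,W_{k-1},Y_k)\ \text{ for all } l=1,\dots,t\Big\},$$ where $H$ is conditional entropy in bits. -/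

import Mathlib

open scoped NNReal

noncomputable section

namespace SuccRef

/-- The probability `Pr[A = a]` when the outcome is drawn according to the pmf `p`. -/
def prob {Ω α : Type*} (p : PMF Ω) (A : Ω → α) (a : α) : ℝ :=
  (p.map A a).toReal

/-- The conditional entropy `H(A | B)`, in bits. The convention `0 log 0 = 0` holds
because the logarithm takes a finite value at `0`. -/
def condEntropy {Ω α β : Type*} [Fintype α] [Fintype β] (p : PMF Ω) (A : Ω → α) (B : Ω → β) : ℝ :=
  -∑ a, ∑ b, prob p (fun ω => (A ω, B ω)) (a, b) *
    Real.logb 2 (prob p (fun ω => (A ω, B ω)) (a, b) / prob p B b)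

open Classical in
/-- The Markov chain `A - B - C` under `p`. -/
def IsMarkov {Ω α β γ : Type*} (p : PMF Ω) (A : Ω → α) (B : Ω → β) (C : Ω → γ) : Prop :=
  ∀ a b c, prob p (fun ω => (A ω, B ω, C ω)) (a, b, c) =
    if 0 < prob p B b then
      prob p (fun ω => (A ω, B ω)) (a, b) * prob p (fun ω => (B ω, C ω)) (b, c) / prob p B b
    else 0

/-- Degraded side-information: `X - Y_t - Y_{t-1} - ⋯ - Y_1` is a Markov chain under `q`, i.e.
for every `l` the variables before `Y_l` in the chain, the variable `Y_l`, and the variables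
after `Y_l` form a Markov chain of length three. -/
def IsDegraded {t : ℕ} {X : Type*} {Y : Fin t → Type*} (q : PMF (X × ∀ l, Y l)) : Prop :=
  ∀ l : Fin t, IsMarkov q
    (fun z => (z.1, fun j : {j : Fin t // l < j} => z.2 j))
    (fun z => z.2 l)
    (fun z => fun j : {j : Fin t // j < l} => z.2 j)

/-- A successive-refinement code of blocklength `n`: message sets `M_l = {0, …, size l - 1}`, an
encoder `f : X^n → M_1 × ⋯ × M_t`, and decoders `g_l : M_1 × ⋯ × M_l × Y_l^n → Xhat_l^n`. -/
structure Code {t : ℕ} (X : Type*) (Y Xhat : Fin t → Type*) (n : ℕ) where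
  size : Fin t → ℕ
  enc : (Fin n → X) → ∀ l, Fin (size l)
  dec : ∀ l : Fin t, (∀ k : {k : Fin t // k ≤ l}, Fin (size k)) → (Fin n → Y l) → Fin n → Xhat l

namespace Code

variable {t : ℕ} {X : Type*} {Y Xhat : Fin t → Type*} {n : ℕ}

/-- The rate on channel `l`, in bits per source symbol. -/
def rate (c : Code X Y Xhat n) (l : Fin t) : ℝ :=
  1 / (n : ℝ) * Real.logb 2 (c.size l)

/-- The replica produced by decoder `l` when the source and side-information sequences are `z`. -/
def replica (c : Code X Y Xhat n) (l : Fin t) (z : Fin n → X × ∀ l, Y l) : Fin n → Xhat l :=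
  c.dec l (fun k => c.enc (fun i => (z i).1) k) (fun i => (z i).2 l)

/-- The average distortion at decoder `l` when the `n` letters are drawn iid according to `q`. -/
def distortion [Fintype X] [∀ l, Fintype (Y l)] (c : Code X Y Xhat n) (q : PMF (X × ∀ l, Y l))
    (δ : ∀ l, X → Xhat l → ℝ≥0) (l : Fin t) : ℝ :=
  ∑ z : Fin n → X × ∀ l, Y l,
    (∏ i, (q (z i)).toReal) * (1 / (n : ℝ) * ∑ i, (δ l (z i).1 (c.replica l z i) : ℝ))

end Code

/-- The region `R(d)` of all `d`-admissible rate tuples. -/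
def rateRegion {t : ℕ} {X : Type*} {Y Xhat : Fin t → Type*} [Fintype X] [∀ l, Fintype (Y l)]
    (q : PMF (X × ∀ l, Y l)) (δ : ∀ l, X → Xhat l → ℝ≥0) (d : Fin t → ℝ≥0) :
    Set (Fin t → ℝ≥0) :=
  {r | ∀ ε : ℝ, 0 < ε → ∃ n : ℕ, 0 < n ∧ ∃ c : Code X Y Xhat n,
    (∀ l, c.distortion q δ l ≤ d l + ε) ∧ (∀ l, c.rate l ≤ r l + ε)}

open Classical in
/-- The distortion measure for recovering the private message `W_l` at decoder `l`:
`0` if `w_l` is reproduced correctly and `1` otherwise. -/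
def privateDistortion {t : ℕ} (W : Fin t → Type*) (l : Fin t) (w : ∀ k, W k) (what : W l) : ℝ≥0 :=
  if w l = what then 0 else 1

end SuccRef

end

namespace SuccRef

/-! Converse: a change of measure replaces the usual chain of entropy inequalities. With the
messages frozen, each decoder is a function of its side-information; blurred by `noisyCopy` it
becomes a substochastic kernel `Q_k(w_k | y_k)`. Degradedness makes the mean of `∏ₖ Q_k(w_k | y_k) /
P(w_k | w_{<k}, y_k)` at most one (`IsDegraded.sum_likelihoodRatio_le`): factors are removed from
the largest `k` down, since given `(w_{<k}, y_k)` the letter `w_k` is independent of `y_{<k}`.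
Summing over the message tuples bounds the ratio of an actual code by the number of tuples
(`IsDegraded.sum_code_ratio_le`). Jensen's inequality for the logarithm then compares rates with
conditional entropies, up to terms that vanish with the error probability and the blur.
Achievability: `W_k` is randomly binned at a rate slightly above `H(W_k | W_{<k}, Y_k)`. One binning
serves every decoder `l ≥ k`, because degradedness gives `H(W_k | W_{<k}, Y_l) ≤ H(W_k | W_{<k},
Y_k)` (`eventually_exists_hash`, `IsDegraded.condEntropy_le`). The partial-sum conditions are
exactly what lets the bin bits of stage `k` be carried by messages `1, …, k`
(`exists_injective_sigma`), so decoder `l` can recover `W_1, …, W_l` in turn. -/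

open scoped Classical in
/-- The total weight that `p` gives to the fibre of `S` over `s`. -/
noncomputable def mass {Z σ : Type*} [Fintype Z] (p : Z → ℝ) (S : Z → σ) (s : σ) : ℝ :=
  ∑ z with S z = s, p z

/-! ### Fibre masses, product weights and change of kernel -/

section Mass

variable {Z σ τ ν : Type*} [Fintype Z] {p : Z → ℝ}

open scoped Classical in
theorem mass_eq_sum_ite (p : Z → ℝ) (S : Z → σ) (s : σ) :
    mass p S s = ∑ z, p z * if S z = s then 1 else 0 := by
  simp [mass, Finset.sum_filter]

theorem prob_eq_mass (q : PMF Z) (A : Z → σ) (a : σ) :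
    prob q A a = mass (fun z => (q z).toReal) A a := by
  classical
  rw [prob, PMF.map_apply, tsum_fintype, mass, Finset.sum_filter, ENNReal.toReal_sum]
  · refine Finset.sum_congr rfl fun z _ => ?_
    by_cases h : A z = a
    · simp [h]
    · simp [h, Ne.symm h]
  · intro z _
    split_ifs
    · exact q.apply_ne_top z
    · simp

theorem sum_toReal_eq_one (q : PMF Z) : ∑ z, (q z).toReal = 1 := by
  rw [← ENNReal.toReal_sum fun z _ => q.apply_ne_top z, ← tsum_fintype (L := .unconditional Z),
    q.tsum_coe]
  simp

theorem mass_nonneg (hp : ∀ z, 0 ≤ p z) (S : Z → σ) (s : σ) : 0 ≤ mass p S s :=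
  Finset.sum_nonneg fun z _ => hp z

theorem le_mass (hp : ∀ z, 0 ≤ p z) (S : Z → σ) (z : Z) : p z ≤ mass p S (S z) :=
  Finset.single_le_sum (f := p) (fun z _ => hp z) (by simp)

theorem mass_le_mass_comp (hp : ∀ z, 0 ≤ p z) (S : Z → σ) (f : σ → τ) (s : σ) :
    mass p S s ≤ mass p (fun z => f (S z)) (f s) := by
  classical
  refine Finset.sum_le_sum_of_subset_of_nonneg ?_ fun z _ _ => hp z
  intro z
  simp only [Finset.mem_filter, Finset.mem_univ, true_and]
  rintro rfl
  rfl

theorem sum_mass_mul [Fintype σ] (p : Z → ℝ) (S : Z → σ) (F : σ → ℝ) :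
    ∑ s, mass p S s * F s = ∑ z, p z * F (S z) := by
  classical
  rw [← Finset.sum_fiberwise (s := Finset.univ) (g := S)]
  refine Finset.sum_congr rfl fun s _ => ?_
  rw [mass, Finset.sum_mul]
  refine Finset.sum_congr rfl fun z hz => ?_
  rw [(Finset.mem_filter.1 hz).2]

theorem sum_mass_pair [Fintype ν] (p : Z → ℝ) (S : Z → σ) (V : Z → ν) (s : σ) :
    ∑ v, mass p (fun z => (V z, S z)) (v, s) = mass p S s := by
  classical
  simp only [mass_eq_sum_ite, Prod.mk.injEq]
  rw [Finset.sum_comm]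
  refine Finset.sum_congr rfl fun z _ => ?_
  rw [← Finset.mul_sum]
  by_cases h : S z = s <;> simp [h]

theorem mass_pi {n : ℕ} (p : Z → ℝ) (S : Z → σ) (s : Fin n → σ) :
    mass (fun z : Fin n → Z => ∏ i, p (z i)) (fun z i => S (z i)) s = ∏ i, mass p S (s i) := by
  classical
  simp only [mass]
  rw [Finset.prod_univ_sum]
  refine Finset.sum_congr ?_ fun _ _ => rfl
  ext z
  simp [funext_iff]

theorem sum_prod_pi {n : ℕ} (F : Fin n → Z → ℝ) :
    ∑ z : Fin n → Z, ∏ i, F i (z i) = ∏ i, ∑ z, F i z := by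
  classical
  rw [Finset.prod_univ_sum]
  simp

/-- Changing the conditional law `c` of `V` given `S` to a substochastic kernel `Q`. -/
theorem sum_mul_div_cond_le [Fintype σ] [Fintype ν] (hp : ∀ z, 0 ≤ p z) (S : Z → σ) (V : Z → ν)
    (c : ν → σ → ℝ) (hc : ∀ v s, mass p (fun z => (V z, S z)) (v, s) = mass p S s * c v s)
    (φ : Z → ℝ) (hφ : ∀ z, 0 ≤ φ z) (hφS : Function.FactorsThrough φ S)
    (Q : ν → σ → ℝ) (hQ : ∀ v s, 0 ≤ Q v s) (hQs : ∀ s, ∑ v, Q v s ≤ 1) :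
    ∑ z, p z * (φ z * (Q (V z) (S z) / c (V z) (S z))) ≤ ∑ z, p z * φ z := by
  classical
  -- `φ` descends to a function on `σ`; the value `0` off the range of `S` keeps it nonnegative
  -- everywhere.
  set ψ : σ → ℝ := Function.extend S φ 0 with hψ
  have hψS : ∀ z, ψ (S z) = φ z := fun z => hφS.extend_apply _ _
  have hψ0 : ∀ s, 0 ≤ ψ s := by
    intro s
    by_cases h : ∃ z, S z = s
    · obtain ⟨z, rfl⟩ := h
      rw [hψS]; exact hφ z
    · rw [hψ, Function.extend_apply' _ _ _ h]; rfl
  simp only [← hψS]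
  rw [← sum_mass_mul p (fun z => (V z, S z)) (fun x => ψ x.2 * (Q x.1 x.2 / c x.1 x.2)),
    ← sum_mass_mul p S ψ, Fintype.sum_prod_type_right]
  refine Finset.sum_le_sum fun s _ => ?_
  calc ∑ v, mass p (fun z => (V z, S z)) (v, s) * (ψ s * (Q v s / c v s))
      ≤ ∑ v, mass p S s * ψ s * Q v s := by
        refine Finset.sum_le_sum fun v _ => ?_
        rw [hc]
        have h0 : 0 ≤ mass p S s * ψ s * Q v s :=
          mul_nonneg (mul_nonneg (mass_nonneg hp _ _) (hψ0 s)) (hQ v s)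
        -- Where `c` vanishes the quotient is `0` and `Q` may lose mass; this is why only an
        -- inequality holds.
        by_cases h : c v s = 0
        · simpa [h] using h0
        · apply le_of_eq
          field_simp
    _ = mass p S s * ψ s * ∑ v, Q v s := by rw [Finset.mul_sum]
    _ ≤ mass p S s * ψ s * 1 :=
        mul_le_mul_of_nonneg_left (hQs s) (mul_nonneg (mass_nonneg hp _ _) (hψ0 s))
    _ = mass p S s * ψ s := mul_one _

end Mass

/-! ### Conditional probabilities -/

section Cond

variable {Z ν β : Type*} [Fintype Z] {p : Z → ℝ}

/-- The conditional probability of `V = v` given `B = b`. -/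
noncomputable def cond (p : Z → ℝ) (V : Z → ν) (B : Z → β) (v : ν) (b : β) : ℝ :=
  mass p (fun z => (V z, B z)) (v, b) / mass p B b

theorem cond_nonneg (hp : ∀ z, 0 ≤ p z) (V : Z → ν) (B : Z → β) (v : ν) (b : β) :
    0 ≤ cond p V B v b :=
  div_nonneg (mass_nonneg hp _ _) (mass_nonneg hp _ _)

theorem cond_le_one (hp : ∀ z, 0 ≤ p z) (V : Z → ν) (B : Z → β) (v : ν) (b : β) :
    cond p V B v b ≤ 1 :=
  div_le_one_of_le₀ (mass_le_mass_comp hp (fun z => (V z, B z)) Prod.snd (v, b))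
    (mass_nonneg hp _ _)

theorem cond_pos (hp : ∀ z, 0 ≤ p z) (V : Z → ν) (B : Z → β) {z : Z} (hz : 0 < p z) :
    0 < cond p V B (V z) (B z) :=
  div_pos (hz.trans_le (le_mass hp (fun z => (V z, B z)) z)) (hz.trans_le (le_mass hp B z))

theorem sum_cond_le_one [Fintype ν] (p : Z → ℝ) (V : Z → ν) (B : Z → β) (b : β) :
    ∑ v, cond p V B v b ≤ 1 := by
  simp only [cond]
  rw [← Finset.sum_div, sum_mass_pair]
  exact div_self_le_one _

/-- Writing entropy as a mean over the sample space puts all entropies under one sum, where outcomes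
of weight zero can be discarded. -/
theorem condEntropy_eq_sum [Fintype ν] [Fintype β] (q : PMF Z) (V : Z → ν) (B : Z → β) :
    condEntropy q V B =
      ∑ z, (q z).toReal * -Real.logb 2 (cond (fun z => (q z).toReal) V B (V z) (B z)) := by
  simp only [condEntropy, prob_eq_mass]
  rw [← sum_mass_mul _ (fun z => (V z, B z))
    (fun x => -Real.logb 2 (cond (fun z => (q z).toReal) V B x.1 x.2)), Fintype.sum_prod_type]
  simp [cond, Finset.sum_neg_distrib]

end Cond

/-! ### Markov chains and data processing -/

section Markov

variable {Z α β γ : Type*} [Fintype Z] {q : PMF Z} {A : Z → α} {B : Z → β} {C : Z → γ}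

/-- Cross-multiplying removes the case distinction: if `b` has mass zero, both sides vanish. -/
theorem IsMarkov.mass_mul (h : IsMarkov q A B C) (a : α) (b : β) (c : γ) :
    mass (fun z => (q z).toReal) (fun z => (A z, B z, C z)) (a, b, c) *
        mass (fun z => (q z).toReal) B b =
      mass (fun z => (q z).toReal) (fun z => (A z, B z)) (a, b) *
        mass (fun z => (q z).toReal) (fun z => (B z, C z)) (b, c) := by
  have hp : ∀ z, 0 ≤ (q z).toReal := fun z => ENNReal.toReal_nonneg
  have := h a b c
  simp only [prob_eq_mass] at this
  rw [this]
  split_ifs with hb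
  · field_simp
  · have h0 : mass (fun z => (q z).toReal) B b = 0 := le_antisymm (not_lt.1 hb) (mass_nonneg hp _ _)
    have := mass_le_mass_comp hp (fun z => (A z, B z)) Prod.snd (a, b)
    have h1 : mass (fun z => (q z).toReal) (fun z => (A z, B z)) (a, b) = 0 :=
      le_antisymm (this.trans h0.le) (mass_nonneg hp _ _)
    simp [h1]

/-- A Markov chain in expectation form. -/
theorem IsMarkov.sum_mul [Fintype α] [Fintype β] [Fintype γ] (h : IsMarkov q A B C)
    (f : α → ℝ) (g : γ → ℝ) (e : β → ℝ) (b : β) (he : ∀ b', b' ≠ b → e b' = 0) :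
    (∑ z, (q z).toReal * (e (B z) * f (A z) * g (C z))) *
        (∑ z, (q z).toReal * e (B z)) =
      (∑ z, (q z).toReal * (e (B z) * f (A z))) * ∑ z, (q z).toReal * (e (B z) * g (C z)) := by
  set p : Z → ℝ := fun z => (q z).toReal
  have key : ∀ F : β → ℝ, (∀ b', b' ≠ b → F b' = 0) → ∑ b', F b' = F b := fun F hF =>
    Fintype.sum_eq_single b hF
  have h1 := sum_mass_mul p (fun z => (A z, B z, C z)) (fun x => e x.2.1 * f x.1 * g x.2.2)
  have h2 := sum_mass_mul p B e
  have h3 := sum_mass_mul p (fun z => (A z, B z)) (fun x => e x.2 * f x.1)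
  have h4 := sum_mass_mul p (fun z => (B z, C z)) (fun x => e x.1 * g x.2)
  simp only at h1 h2 h3 h4
  rw [← h1, ← h2, ← h3, ← h4]
  simp only [Fintype.sum_prod_type]
  -- As `e` is supported at `b`, each sum over `b'` collapses to one term.
  rw [key (fun b' => mass p B b' * e b') (fun b' hb => by simp [he b' hb]),
    key (fun b' => ∑ c, mass p (fun z => (B z, C z)) (b', c) * (e b' * g c))
      (fun b' hb => by simp [he b' hb]),
    Finset.sum_congr rfl fun a _ => key
      (fun b' => ∑ c, mass p (fun z => (A z, B z, C z)) (a, b', c) * (e b' * f a * g c))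
      (fun b' hb => by simp [he b' hb]),
    Finset.sum_congr rfl fun a _ => key
      (fun b' => mass p (fun z => (A z, B z)) (a, b') * (e b' * f a))
      (fun b' hb => by simp [he b' hb])]
  rw [Finset.sum_mul_sum, Finset.sum_mul]
  refine Finset.sum_congr rfl fun a _ => ?_
  rw [Finset.sum_mul]
  refine Finset.sum_congr rfl fun c _ => ?_
  have := h.mass_mul a b c
  linear_combination (e b * f a * g c * e b) * this

/-- Both ends of a Markov chain may be processed. -/
theorem IsMarkov.mass_comp_mul [Fintype α] [Fintype β] [Fintype γ] (h : IsMarkov q A B C)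
    {α' γ' : Type*} (f : α → α') (g : γ → γ') (a : α') (b : β) (c : γ') :
    mass (fun z => (q z).toReal) (fun z => (f (A z), B z, g (C z))) (a, b, c) *
        mass (fun z => (q z).toReal) B b =
      mass (fun z => (q z).toReal) (fun z => (f (A z), B z)) (a, b) *
        mass (fun z => (q z).toReal) (fun z => (B z, g (C z))) (b, c) := by
  classical
  have := h.sum_mul (fun x => if f x = a then 1 else 0) (fun x => if g x = c then 1 else 0)
    (fun x => if x = b then 1 else 0) b (by simp +contextual)
  simp only [mass_eq_sum_ite, Prod.mk.injEq]
  convert this using 6 <;> split_ifs <;> simp_all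

theorem mass_eq_of_equiv {σ τ : Type*} (p : Z → ℝ) {S : Z → σ} {T : Z → τ} {s : σ} {t : τ}
    (h : ∀ z, S z = s ↔ T z = t) : mass p S s = mass p T t := by
  classical
  simp only [mass]
  exact Finset.sum_congr (by ext z; simp [h z]) fun _ _ => rfl

/-- If `(V, U) - B - C` is a Markov chain, then given `(U, B)` the variable `V` does not depend
on `C`. -/
theorem IsMarkov.mass_eq_mul_cond [Fintype α] [Fintype β] [Fintype γ] (h : IsMarkov q A B C)
    {ν υ γ' : Type*} (v : α → ν) (u : α → υ) (g : γ → γ') (x : ν) (y : υ) (b : β) (c : γ') :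
    mass (fun z => (q z).toReal) (fun z => (v (A z), (u (A z), B z), g (C z))) (x, (y, b), c) =
      mass (fun z => (q z).toReal) (fun z => ((u (A z), B z), g (C z))) ((y, b), c) *
        cond (fun z => (q z).toReal) (fun z => v (A z)) (fun z => (u (A z), B z)) x (y, b) := by
  set p : Z → ℝ := fun z => (q z).toReal with hpdef
  have hp : ∀ z, 0 ≤ p z := fun z => ENNReal.toReal_nonneg
  have h1 := h.mass_comp_mul (fun a => (v a, u a)) g (x, y) b c
  have h2 := h.mass_comp_mul u g y b c
  rw [mass_eq_of_equiv p (T := fun z => (v (A z), (u (A z), B z), g (C z))) (t := (x, (y, b), c))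
    (fun z => by simp; tauto), mass_eq_of_equiv p (S := fun z => ((v (A z), u (A z)), B z))
    (T := fun z => (v (A z), (u (A z), B z))) (t := (x, (y, b))) (fun z => by simp; tauto)] at h1
  rw [mass_eq_of_equiv p (S := fun z => (u (A z), B z, g (C z)))
    (T := fun z => ((u (A z), B z), g (C z))) (t := ((y, b), c)) (fun z => by simp; tauto)] at h2
  rw [cond]
  have m1 := mass_le_mass_comp hp (fun z => (v (A z), (u (A z), B z), g (C z)))
    (fun s => s.2.1) (x, (y, b), c)
  have m2 := mass_le_mass_comp hp (fun z => (u (A z), B z)) (fun s => s.2) (y, b)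
  have m3 := mass_nonneg hp (fun z => (v (A z), (u (A z), B z), g (C z))) (x, (y, b), c)
  simp only at m1 m2
  change _ = _ * (_ / mass p (fun z => (u (A z), B z)) (y, b))
  by_cases h0 : mass p (fun z => (u (A z), B z)) (y, b) = 0
  · rw [h0]
    rw [h0] at m1
    simp only [div_zero, mul_zero]
    exact le_antisymm m1 m3
  · have hb : mass p B b ≠ 0 := by
      intro hb
      rw [hb] at m2
      exact h0 (le_antisymm m2 (mass_nonneg hp _ _))
    rw [mul_div_assoc', eq_div_iff h0]
    apply mul_right_cancel₀ hb
    linear_combination (mass p (fun z => (u (A z), B z)) (y, b)) * h1 -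
      mass p (fun z => (v (A z), (u (A z), B z))) (x, (y, b)) * h2

end Markov

/-- If `(V, U) - B - C` is a Markov chain, then `H(V | U, B) ≤ H(V | U, C)`. -/
theorem IsMarkov.condEntropy_le {Z α β γ ν υ γ' : Type*} [Fintype Z] [Fintype α] [Fintype β]
    [Fintype γ] [Fintype ν] [Fintype υ] [Fintype γ'] {q : PMF Z} {A : Z → α} {B : Z → β}
    {C : Z → γ} (h : IsMarkov q A B C) (v : α → ν) (u : α → υ) (g : γ → γ') :
    condEntropy q (fun z => v (A z)) (fun z => (u (A z), B z)) ≤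
      condEntropy q (fun z => v (A z)) (fun z => (u (A z), g (C z))) := by
  have hp : ∀ z, 0 ≤ (q z).toReal := fun z => ENNReal.toReal_nonneg
  -- Nonnegativity of relative entropy: the ratio `P(V | U, C) / P(V | U, B)` has mean at most one,
  -- and `log x ≤ x - 1` finishes.
  have hK := sum_mul_div_cond_le hp (fun z => ((u (A z), B z), g (C z))) (fun z => v (A z))
    (fun x s => cond (fun z => (q z).toReal) (fun z => v (A z)) (fun z => (u (A z), B z)) x s.1)
    (fun x s => h.mass_eq_mul_cond v u g x s.1.1 s.1.2 s.2) (fun _ => 1) (fun _ => zero_le_one)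
    (fun _ _ _ => rfl)
    (fun x s => cond (fun z => (q z).toReal) (fun z => v (A z)) (fun z => (u (A z), g (C z))) x
      (s.1.1, s.2)) (fun _ _ => cond_nonneg hp _ _ _ _) (fun s => sum_cond_le_one _ _ _ _)
  rw [condEntropy_eq_sum, condEntropy_eq_sum, ← sub_nonpos, ← Finset.sum_sub_distrib]
  have hl : 0 < Real.log 2 := Real.log_pos one_lt_two
  refine le_trans (Finset.sum_le_sum (g := fun z => ((q z).toReal * (1 *
    (cond (fun z => (q z).toReal) (fun z => v (A z)) (fun z => (u (A z), g (C z))) (v (A z))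
      (u (A z), g (C z)) /
    cond (fun z => (q z).toReal) (fun z => v (A z)) (fun z => (u (A z), B z)) (v (A z))
      (u (A z), B z))) - (q z).toReal * 1) / Real.log 2) fun z _ => ?_) ?_
  · rcases (hp z).eq_or_lt with h0 | h0
    · simp [← h0]
    · have h1 := cond_pos hp (fun z => v (A z)) (fun z => (u (A z), B z)) h0
      have h2 := cond_pos hp (fun z => v (A z)) (fun z => (u (A z), g (C z))) h0
      have h3 := Real.log_le_sub_one_of_pos (div_pos h2 h1)
      rw [Real.log_div h2.ne' h1.ne'] at h3
      rw [le_div_iff₀ hl]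
      simp only [Real.logb]
      have h4 := mul_le_mul_of_nonneg_left h3 (hp z)
      field_simp
      field_simp at h4
      linarith
  · rw [← Finset.sum_div, Finset.sum_sub_distrib]
    exact div_nonpos_of_nonpos_of_nonneg (sub_nonpos.2 hK) hl.le

/-! ### Converse: the likelihood ratio -/

section Converse

variable {t : ℕ} {W Y : Fin t → Type*} [∀ l, Fintype (W l)] [∀ l, Fintype (Y l)]
  {q : PMF ((∀ l, W l) × ∀ l, Y l)}

/-- The conditional probability of the letter `w_k` given `w_1, …, w_{k-1}` and `y_k`. -/
noncomputable def letterCond (q : PMF ((∀ l, W l) × ∀ l, Y l)) (k : Fin t)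
    (z : (∀ l, W l) × ∀ l, Y l) : ℝ :=
  cond (fun z => (q z).toReal) (fun z => z.1 k)
    (fun z => ((fun j : {j : Fin t // j < k} => z.1 j), z.2 k)) (z.1 k)
    ((fun j : {j : Fin t // j < k} => z.1 j), z.2 k)

/-- The joint law of source and side-information factors through the conditional letter
probabilities: for substochastic kernels `Q_k` the likelihood ratio has mean at most one. -/
theorem IsDegraded.sum_likelihoodRatio_le (hq : IsDegraded q) {n : ℕ}
    (Q : ∀ k, (Fin n → W k) → (Fin n → Y k) → ℝ) (hQ : ∀ k w y, 0 ≤ Q k w y)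
    (hQs : ∀ k y, ∑ w, Q k w y ≤ 1) (j : ℕ) (hj : j ≤ t) :
    ∑ z : Fin n → (∀ l, W l) × ∀ l, Y l, (∏ i, (q (z i)).toReal) *
      ∏ k : Fin t with k.val < j, (Q k (fun i => (z i).1 k) (fun i => (z i).2 k) /
        ∏ i, letterCond q k (z i)) ≤ 1 := by
  have hp : ∀ z, 0 ≤ (q z).toReal := fun z => ENNReal.toReal_nonneg
  induction j with
  | zero =>
    simp only [not_lt_zero, Finset.filter_false, Finset.prod_empty, mul_one]
    rw [sum_prod_pi (fun (_ : Fin n) z => (q z).toReal)]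
    simp [sum_toReal_eq_one]
  | succ j ih =>
    refine le_trans ?_ (ih (by omega))
    obtain ⟨l, rfl⟩ : ∃ l : Fin t, j = l.val := ⟨⟨j, hj⟩, rfl⟩
    have hfil : (Finset.univ.filter fun k : Fin t => k.val < l.val + 1) =
        insert l (Finset.univ.filter fun k : Fin t => k.val < l.val) := by
      ext k
      simp only [Finset.mem_filter, Finset.mem_univ, true_and, Finset.mem_insert, Fin.ext_iff]
      omega
    rw [hfil]
    simp only [Finset.prod_insert (show l ∉ (Finset.univ.filter fun k : Fin t => k.val < l.val) by
      simp)]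
    -- The factor of the largest index `l` is integrated out. The conditioning variable `(W_{<l},
    -- Y_l, Y_{<l})` determines all remaining factors, and by the Markov chain the conditional law
    -- of `W_l` given it does not involve `Y_{<l}`.
    have hK := sum_mul_div_cond_le (p := fun z : Fin n → (∀ l, W l) × ∀ l, Y l =>
        ∏ i, (q (z i)).toReal) (fun z => Finset.prod_nonneg fun i _ => hp (z i))
      (fun z i => (((fun j : {j : Fin t // j < l} => (z i).1 j), (z i).2 l),
        fun j : {j : Fin t // j < l} => (z i).2 j)) (fun z i => (z i).1 l)
      (fun v s => ∏ i, cond (fun z => (q z).toReal) (fun z => z.1 l)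
        (fun z => ((fun j : {j : Fin t // j < l} => z.1 j), z.2 l)) (v i) (s i).1)
      (fun v s => ?_)
      (fun z => ∏ k : Fin t with k.val < l.val, (Q k (fun i => (z i).1 k) (fun i => (z i).2 k) /
        ∏ i, letterCond q k (z i)))
      (fun z => Finset.prod_nonneg fun k _ => div_nonneg (hQ _ _ _)
        (Finset.prod_nonneg fun i _ => cond_nonneg hp _ _ _ _))
      (fun z z' hz => ?_)
      (fun v s => Q l v fun i => (s i).1.2) (fun _ _ => hQ _ _ _) (fun _ => hQs _ _)
    · refine le_trans (le_of_eq (Finset.sum_congr rfl fun z _ => ?_)) hK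
      rw [mul_comm (_ / _)]
      rfl
    · have e1 := mass_pi (fun z => (q z).toReal)
        (fun z : (∀ l, W l) × ∀ l, Y l => (((fun j : {j : Fin t // j < l} => z.1 j), z.2 l),
          fun j : {j : Fin t // j < l} => z.2 j)) s
      have e2 := mass_pi (fun z => (q z).toReal)
        (fun z : (∀ l, W l) × ∀ l, Y l => (z.1 l, ((fun j : {j : Fin t // j < l} => z.1 j), z.2 l),
          fun j : {j : Fin t // j < l} => z.2 j)) (fun i => (v i, s i))
      rw [e1, ← Finset.prod_mul_distrib]
      refine Eq.trans (mass_eq_of_equiv _ fun z => ?_) (e2.trans (Finset.prod_congr rfl fun i _ =>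
        (hq l).mass_eq_mul_cond (fun a => a.1 l)
          (fun a => fun j : {j : Fin t // j < l} => a.1 j) id (v i) (s i).1.1 (s i).1.2 (s i).2))
      simp only [Prod.mk.injEq, funext_iff, forall_and]
    · refine Finset.prod_congr rfl fun k hk => ?_
      have hk : k < l := (Finset.mem_filter.1 hk).2
      have hw : ∀ j, j < l → ∀ i, (z i).1 j = (z' i).1 j := fun j hj i =>
        congrFun (congrArg (fun s => s.1.1) (congrFun hz i)) ⟨j, hj⟩
      have hy : ∀ j, j < l → ∀ i, (z i).2 j = (z' i).2 j := fun j hj i =>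
        congrFun (congrArg (fun s => s.2) (congrFun hz i)) ⟨j, hj⟩
      have hU : ∀ i, (fun j : {j : Fin t // j < k} => (z i).1 j) =
          fun j : {j : Fin t // j < k} => (z' i).1 j :=
        fun i => funext fun j => hw j (j.2.trans hk) i
      simp only [letterCond, hw k hk, hy k hk, hU]

end Converse

/-! ### Means under product weights and Jensen's inequality -/

theorem sum_pi_mul_apply {Z : Type*} [Fintype Z] {p : Z → ℝ} (hp : ∑ z, p z = 1) {n : ℕ}
    (f : Z → ℝ) (i : Fin n) :
    ∑ z : Fin n → Z, (∏ j, p (z j)) * f (z i) = ∑ z, p z * f z := by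
  have h := sum_prod_pi (fun (j : Fin n) z => p z * if j = i then f z else 1)
  simp only [Finset.prod_mul_distrib, Finset.prod_ite_eq', Finset.mem_univ, if_true] at h
  rw [h, Finset.prod_eq_single i]
  · simp
  · intro j _ hj
    simp [hj, hp]
  · simp

theorem sum_pi_mul_sum {Z : Type*} [Fintype Z] {p : Z → ℝ} (hp : ∑ z, p z = 1) (n : ℕ)
    (f : Z → ℝ) :
    ∑ z : Fin n → Z, (∏ j, p (z j)) * ∑ i, f (z i) = n * ∑ z, p z * f z := by
  simp only [Finset.mul_sum]
  rw [Finset.sum_comm, Finset.sum_congr rfl fun i _ => sum_pi_mul_apply hp f i]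
  simp [Finset.mul_sum]

theorem sum_mul_logb_le {Z : Type*} [Fintype Z] {p : Z → ℝ} (hp : ∀ z, 0 ≤ p z)
    (hp1 : ∑ z, p z = 1) {X : Z → ℝ} (hX : ∀ z, 0 < p z → 0 < X z) {a : ℝ} (ha : 0 < a)
    (h : ∑ z, p z * X z ≤ a) : ∑ z, p z * Real.logb 2 (X z) ≤ Real.logb 2 a := by
  have hl : 0 < Real.log 2 := Real.log_pos one_lt_two
  simp only [Real.logb, ← mul_div_assoc]
  rw [← Finset.sum_div]
  refine div_le_div_of_nonneg_right ?_ hl.le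
  -- The tangent line of `log` at `a` lies above `log`.
  calc ∑ z, p z * Real.log (X z) ≤ ∑ z, (p z * X z / a + p z * (Real.log a - 1)) := by
        refine Finset.sum_le_sum fun z _ => ?_
        rcases (hp z).eq_or_lt with h0 | h0
        · simp [← h0]
        · have h1 := Real.log_le_sub_one_of_pos (div_pos (hX z h0) ha)
          rw [Real.log_div (hX z h0).ne' ha.ne'] at h1
          rw [mul_div_assoc, ← mul_add]
          exact mul_le_mul_of_nonneg_left (by linarith) h0.le
    _ = (∑ z, p z * X z) / a + (Real.log a - 1) := by
        rw [Finset.sum_add_distrib, ← Finset.sum_div, ← Finset.sum_mul, hp1, one_mul]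
    _ ≤ 1 + (Real.log a - 1) := by
        gcongr
        exact div_le_one_of_le₀ h ha.le
    _ = Real.log a := by ring

/-! ### Blurred reconstructions -/

open scoped Classical in
/-- The kernel that reproduces its input with probability about `1 - δ`. -/
noncomputable def noisyCopy (α : Type*) [Fintype α] (δ : ℝ) (a b : α) : ℝ :=
  if a = b then 1 - δ else δ / Fintype.card α

section NoisyCopy

variable {α : Type*} [Fintype α] {δ : ℝ}

theorem noisyCopy_pos (h0 : 0 < δ) (h1 : δ < 1) (a b : α) : 0 < noisyCopy α δ a b := by
  have : 0 < Fintype.card α := Fintype.card_pos_iff.2 ⟨a⟩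
  unfold noisyCopy
  split_ifs
  · linarith
  · positivity

theorem sum_noisyCopy_le (h0 : 0 < δ) (b : α) : ∑ a, noisyCopy α δ a b ≤ 1 := by
  classical
  have hc : 0 < Fintype.card α := Fintype.card_pos_iff.2 ⟨b⟩
  -- Adding `δ / card α` on the diagonal too makes the total exactly one.
  calc ∑ a, noisyCopy α δ a b ≤ ∑ a, ((if a = b then 1 - δ else 0) + δ / Fintype.card α) := by
        refine Finset.sum_le_sum fun a _ => ?_
        unfold noisyCopy
        have : 0 < δ / Fintype.card α := by positivity
        split_ifs <;> linarith
    _ = 1 := by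
        rw [Finset.sum_add_distrib]
        simp only [Finset.sum_ite_eq', Finset.mem_univ, if_true, Finset.sum_const, Finset.card_univ,
          nsmul_eq_mul]
        field_simp
        ring

theorem sum_prod_noisyCopy_le (h0 : 0 < δ) (h1 : δ < 1) {n : ℕ} (b : Fin n → α) :
    ∑ a : Fin n → α, ∏ i, noisyCopy α δ (a i) (b i) ≤ 1 := by
  rw [sum_prod_pi (fun i a => noisyCopy α δ a (b i))]
  exact Finset.prod_le_one
    (fun i _ => Finset.sum_nonneg fun a _ => (noisyCopy_pos h0 h1 a _).le)
    (fun i _ => sum_noisyCopy_le h0 _)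

-- Takes the place of Fano's inequality: the blur keeps the likelihood positive, so a symbol error
-- costs only a bounded amount.
open scoped Classical in
theorem le_logb_noisyCopy (h0 : 0 < δ) (h1 : δ < 1) (a b : α) :
    Real.logb 2 (1 - δ) - (if a = b then 0 else 1) * Real.logb 2 (Fintype.card α / δ) ≤
      Real.logb 2 (noisyCopy α δ a b) := by
  unfold noisyCopy
  split_ifs
  · simp
  · rw [one_mul, ← inv_div (Fintype.card α : ℝ) δ, Real.logb_inv]
    have : Real.logb 2 (1 - δ) ≤ 0 := Real.logb_nonpos one_lt_two (by linarith) (by linarith)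
    linarith

end NoisyCopy

/-! ### Converse: from the ratio to the rates -/

section Converse

variable {t : ℕ} {W Y : Fin t → Type*} [∀ l, Fintype (W l)] [∀ l, Fintype (Y l)]
  {q : PMF ((∀ l, W l) × ∀ l, Y l)}

theorem letterCond_pos {z : (∀ l, W l) × ∀ l, Y l} (hz : 0 < (q z).toReal) (k : Fin t) :
    0 < letterCond q k z :=
  cond_pos (p := fun z => (q z).toReal) (fun _ => ENNReal.toReal_nonneg) (fun z => z.1 k)
    (fun z => ((fun j : {j : Fin t // j < k} => z.1 j), z.2 k)) hz

theorem condEntropy_eq_sum_letterCond (q : PMF ((∀ l, W l) × ∀ l, Y l)) (k : Fin t) :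
    condEntropy q (fun z => z.1 k) (fun z => ((fun j : {j : Fin t // j < k} => z.1 j), z.2 k)) =
      ∑ z, (q z).toReal * -Real.logb 2 (letterCond q k z) :=
  condEntropy_eq_sum _ _ _

theorem sum_prod_toReal (q : PMF ((∀ l, W l) × ∀ l, Y l)) (n : ℕ) :
    ∑ z : Fin n → (∀ l, W l) × ∀ l, Y l, ∏ i, (q (z i)).toReal = 1 := by
  rw [sum_prod_pi (fun (_ : Fin n) z => (q z).toReal)]
  simp [sum_toReal_eq_one]

/-- The mean likelihood ratio of a code is at most the number of messages. -/
theorem IsDegraded.sum_code_ratio_le (hq : IsDegraded q) {n : ℕ} (c : Code (∀ l, W l) Y W n)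
    {δ : ℝ} (h0 : 0 < δ) (h1 : δ < 1) (l : Fin t) :
    ∑ z : Fin n → (∀ l, W l) × ∀ l, Y l, (∏ i, (q (z i)).toReal) *
      ∏ k ∈ Finset.Iic l, ((∏ i, noisyCopy (W k) δ ((z i).1 k) (c.replica k z i)) /
        ∏ i, letterCond q k (z i)) ≤ ∏ k ∈ Finset.Iic l, (c.size k : ℝ) := by
  classical
  have hp : ∀ z, 0 ≤ (q z).toReal := fun z => ENNReal.toReal_nonneg
  obtain ⟨z₀, -⟩ := q.support_nonempty
  -- The decoders with the messages frozen at `m`. For `k > l` the tuple is too short, and an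
  -- arbitrary constant serves.
  let g : (∀ k : {k : Fin t // k ≤ l}, Fin (c.size k)) → ∀ k, (Fin n → Y k) → Fin n → W k :=
    fun m k y => if hk : k ≤ l then c.dec k (fun j => m ⟨j, j.2.trans hk⟩) y else fun _ => z₀.1 k
  have hg : ∀ z : Fin n → (∀ l, W l) × ∀ l, Y l, ∀ k ∈ Finset.Iic l,
      g (fun j : {k : Fin t // k ≤ l} => c.enc (fun i => (z i).1) j) k (fun i => (z i).2 k) = c.replica k z := by
    intro z k hk
    simp only [g, Finset.mem_Iic.1 hk, dif_pos]
    rfl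
  let R : (∀ k : {k : Fin t // k ≤ l}, Fin (c.size k)) →
      (Fin n → (∀ l, W l) × ∀ l, Y l) → ℝ := fun m z =>
    ∏ k ∈ Finset.Iic l, ((∏ i, noisyCopy (W k) δ ((z i).1 k) (g m k (fun i => (z i).2 k) i)) /
      ∏ i, letterCond q k (z i))
  have hR : ∀ m z, 0 ≤ R m z := fun m z => Finset.prod_nonneg fun k _ => div_nonneg
    (Finset.prod_nonneg fun i _ => (noisyCopy_pos h0 h1 _ _).le)
    (Finset.prod_nonneg fun i _ => cond_nonneg hp _ _ _ _)
  have hfil : (Finset.univ.filter fun k : Fin t => k.val < l.val + 1) = Finset.Iic l := by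
    ext k
    simp only [Finset.mem_filter, Finset.mem_univ, true_and, Finset.mem_Iic, Fin.le_def]
    omega
  -- The encoder's tuple is one of all the tuples `m`, and every `R m z` is nonnegative.
  calc _ ≤ ∑ z : Fin n → (∀ l, W l) × ∀ l, Y l, (∏ i, (q (z i)).toReal) * ∑ m, R m z := by
        refine Finset.sum_le_sum fun z _ => mul_le_mul_of_nonneg_left ?_
          (Finset.prod_nonneg fun i _ => hp _)
        refine le_trans (le_of_eq ?_) (Finset.single_le_sum (f := fun m => R m z)
          (fun m _ => hR m z) (Finset.mem_univ fun j : {k : Fin t // k ≤ l} => c.enc (fun i => (z i).1) j))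
        refine Finset.prod_congr rfl fun k hk => ?_
        rw [hg z k hk]
    _ = ∑ m, ∑ z : Fin n → (∀ l, W l) × ∀ l, Y l, (∏ i, (q (z i)).toReal) * R m z := by
        simp only [Finset.mul_sum]
        rw [Finset.sum_comm]
    _ ≤ ∑ m : (∀ k : {k : Fin t // k ≤ l}, Fin (c.size k)), (1 : ℝ) := by
        refine Finset.sum_le_sum fun m _ => ?_
        have := hq.sum_likelihoodRatio_le (n := n)
          (fun k w y => ∏ i, noisyCopy (W k) δ (w i) (g m k y i))
          (fun k w y => Finset.prod_nonneg fun i _ => (noisyCopy_pos h0 h1 _ _).le)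
          (fun k y => sum_prod_noisyCopy_le h0 h1 _) (l.val + 1) l.isLt
        rwa [hfil] at this
    _ = ∏ k ∈ Finset.Iic l, (c.size k : ℝ) := by
        rw [Finset.sum_const, nsmul_eq_mul, mul_one, Finset.card_univ, Fintype.card_pi]
        push_cast
        simp only [Fintype.card_fin]
        exact (Finset.prod_subtype (Finset.Iic l) (fun k => Finset.mem_Iic)
          (fun k => (c.size k : ℝ))).symm

/-- Rate, error probability and conditional entropies of a code of positive blocklength. -/
theorem IsDegraded.sum_condEntropy_le (hq : IsDegraded q) {n : ℕ} (hn : 0 < n)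
    (c : Code (∀ l, W l) Y W n) {δ : ℝ} (h0 : 0 < δ) (h1 : δ < 1) (l : Fin t) :
    ∑ k ∈ Finset.Iic l, condEntropy q (fun z => z.1 k)
        (fun z => ((fun j : {j : Fin t // j < k} => z.1 j), z.2 k)) ≤
      ∑ k ∈ Finset.Iic l, (c.rate k - Real.logb 2 (1 - δ) +
        c.distortion q (privateDistortion W) k * Real.logb 2 (Fintype.card (W k) / δ)) := by
  classical
  have hp : ∀ z, 0 ≤ (q z).toReal := fun z => ENNReal.toReal_nonneg
  have hn' : (0 : ℝ) < n := by exact_mod_cast hn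
  obtain ⟨z₀, -⟩ := q.support_nonempty
  have hsize : ∀ k, (0 : ℝ) < c.size k := fun k => by
    exact_mod_cast (c.enc (fun _ => z₀.1) k).pos
  have hpos : ∀ z : Fin n → (∀ l, W l) × ∀ l, Y l, 0 < ∏ i, (q (z i)).toReal →
      ∀ i, 0 < (q (z i)).toReal := fun z hz i =>
    (hp _).lt_of_ne' fun h => hz.ne' (Finset.prod_eq_zero (Finset.mem_univ i) h)
  have hX := sum_mul_logb_le (p := fun z : Fin n → (∀ l, W l) × ∀ l, Y l => ∏ i, (q (z i)).toReal)
    (fun z => Finset.prod_nonneg fun i _ => hp _) (sum_prod_toReal q n)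
    (fun z hz => Finset.prod_pos fun k _ => div_pos
      (Finset.prod_pos fun i _ => noisyCopy_pos h0 h1 _ _)
      (Finset.prod_pos fun i _ => letterCond_pos (hpos z hz i) k))
    (Finset.prod_pos fun k _ => hsize k) (hq.sum_code_ratio_le c h0 h1 l)
  rw [Real.logb_prod _ _ fun k _ => (hsize k).ne'] at hX
  have hterm : ∑ z : Fin n → (∀ l, W l) × ∀ l, Y l, (∏ i, (q (z i)).toReal) *
      ∑ k ∈ Finset.Iic l, (n * Real.logb 2 (1 - δ) -
        (∑ i, (privateDistortion W k (z i).1 (c.replica k z i) : ℝ)) *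
          Real.logb 2 (Fintype.card (W k) / δ) + ∑ i, -Real.logb 2 (letterCond q k (z i))) ≤
      ∑ k ∈ Finset.Iic l, Real.logb 2 (c.size k) := by
    refine le_trans (Finset.sum_le_sum fun z _ => ?_) hX
    -- Only sequences of positive weight have positive letter probabilities, as splitting the
    -- logarithm requires.
    rcases (Finset.prod_nonneg (s := Finset.univ) fun i _ => hp (z i)).eq_or_lt with hz | hz
    · rw [← hz, zero_mul, zero_mul]
    · refine mul_le_mul_of_nonneg_left ?_ hz.le
      have hc : ∀ k, 0 < ∏ i, letterCond q k (z i) := fun k =>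
        Finset.prod_pos fun i _ => letterCond_pos (hpos z hz i) k
      have hN : ∀ k, 0 < ∏ i, noisyCopy (W k) δ ((z i).1 k) (c.replica k z i) := fun k =>
        Finset.prod_pos fun i _ => noisyCopy_pos h0 h1 _ _
      rw [Real.logb_prod _ _ fun k _ => (div_pos (hN k) (hc k)).ne']
      refine Finset.sum_le_sum fun k _ => ?_
      rw [Real.logb_div (hN k).ne' (hc k).ne',
        Real.logb_prod _ _ fun i _ => (noisyCopy_pos h0 h1 _ _).ne',
        Real.logb_prod _ _ fun i _ => (letterCond_pos (hpos z hz i) k).ne', Finset.sum_neg_distrib,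
        ← sub_eq_add_neg]
      refine sub_le_sub_right ?_ _
      refine le_trans (le_of_eq ?_)
        (Finset.sum_le_sum fun i _ => le_logb_noisyCopy h0 h1 ((z i).1 k) (c.replica k z i))
      rw [Finset.sum_sub_distrib, Finset.sum_mul]
      simp [privateDistortion, apply_ite]
  have hsum : ∑ z : Fin n → (∀ l, W l) × ∀ l, Y l, (∏ i, (q (z i)).toReal) *
      ∑ k ∈ Finset.Iic l, (n * Real.logb 2 (1 - δ) -
        (∑ i, (privateDistortion W k (z i).1 (c.replica k z i) : ℝ)) *
          Real.logb 2 (Fintype.card (W k) / δ) + ∑ i, -Real.logb 2 (letterCond q k (z i))) =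
      ∑ k ∈ Finset.Iic l, (n * Real.logb 2 (1 - δ) -
        n * c.distortion q (privateDistortion W) k * Real.logb 2 (Fintype.card (W k) / δ) +
        n * condEntropy q (fun z => z.1 k)
          (fun z => ((fun j : {j : Fin t // j < k} => z.1 j), z.2 k))) := by
    simp only [Finset.mul_sum (s := Finset.Iic l)]
    rw [Finset.sum_comm]
    refine Finset.sum_congr rfl fun k _ => ?_
    rw [condEntropy_eq_sum_letterCond, ← sum_pi_mul_sum (sum_toReal_eq_one q) n
      (fun z => -Real.logb 2 (letterCond q k z))]
    simp only [mul_add, mul_sub, Finset.sum_add_distrib, Finset.sum_sub_distrib]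
    rw [← Finset.sum_mul, sum_prod_toReal, one_mul, Code.distortion, Finset.mul_sum,
      Finset.sum_mul]
    congr 2
    refine Finset.sum_congr rfl fun z _ => ?_
    field_simp
  rw [hsum] at hterm
  have hrate : ∀ k, Real.logb 2 (c.size k) = n * c.rate k := fun k => by
    rw [Code.rate]; field_simp
  simp only [hrate] at hterm
  refine le_of_mul_le_mul_left ?_ hn'
  rw [Finset.mul_sum, Finset.mul_sum, ← sub_nonneg, ← Finset.sum_sub_distrib]
  rw [← sub_nonneg, ← Finset.sum_sub_distrib] at hterm
  refine hterm.trans (le_of_eq (Finset.sum_congr rfl fun k _ => ?_))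
  ring

-- The order of limits matters: `ε → 0` at fixed `δ` removes the term `ε log (card / δ)`, and only
-- then `δ → 0` removes `log (1 - δ)`.
open Filter Topology in
theorem IsDegraded.rateRegion_subset (hq : IsDegraded q) {r : Fin t → ℝ≥0}
    (hr : r ∈ rateRegion q (privateDistortion W) 0) (l : Fin t) :
    ∑ k ∈ Finset.Iic l, condEntropy q (fun z => z.1 k)
        (fun z => ((fun j : {j : Fin t // j < k} => z.1 j), z.2 k)) ≤
      ∑ k ∈ Finset.Iic l, (r k : ℝ) := by
  obtain ⟨z₀, -⟩ := q.support_nonempty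
  set H := ∑ k ∈ Finset.Iic l, condEntropy q (fun z => z.1 k)
        (fun z => ((fun j : {j : Fin t // j < k} => z.1 j), z.2 k)) with hH
  have hδ : ∀ δ : ℝ, 0 < δ → δ < 1 →
      H ≤ ∑ k ∈ Finset.Iic l, ((r k : ℝ) - Real.logb 2 (1 - δ)) := by
    intro δ h0 h1
    have hε : ∀ ε : ℝ, 0 < ε → H ≤ ∑ k ∈ Finset.Iic l, ((r k : ℝ) + ε - Real.logb 2 (1 - δ) +
        ε * Real.logb 2 (Fintype.card (W k) / δ)) := by
      intro ε hε
      obtain ⟨n, hn, c, hd, hc⟩ := hr ε hε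
      refine (hq.sum_condEntropy_le hn c h0 h1 l).trans (Finset.sum_le_sum fun k _ => ?_)
      have hcard : (1 : ℝ) ≤ Fintype.card (W k) := by
        exact_mod_cast Fintype.card_pos_iff.2 ⟨z₀.1 k⟩
      have hL : 0 ≤ Real.logb 2 (Fintype.card (W k) / δ) :=
        Real.logb_nonneg one_lt_two ((one_le_div h0).2 (by linarith))
      have := mul_le_mul_of_nonneg_right (hd k) hL
      simp only [Pi.zero_apply, NNReal.coe_zero, zero_add] at this
      linarith [hc k]
    have hlim : Tendsto (fun ε : ℝ => ∑ k ∈ Finset.Iic l, ((r k : ℝ) + ε - Real.logb 2 (1 - δ) +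
        ε * Real.logb 2 (Fintype.card (W k) / δ))) (𝓝[>] 0)
        (𝓝 (∑ k ∈ Finset.Iic l, ((r k : ℝ) + 0 - Real.logb 2 (1 - δ) +
        0 * Real.logb 2 (Fintype.card (W k) / δ)))) := by
      refine (Continuous.tendsto ?_ 0).mono_left nhdsWithin_le_nhds
      fun_prop
    have := ge_of_tendsto hlim (eventually_nhdsWithin_of_forall fun ε h => hε ε h)
    simpa using this
  have hlim : Tendsto (fun δ : ℝ => ∑ k ∈ Finset.Iic l, ((r k : ℝ) - Real.logb 2 (1 - δ)))
      (𝓝[>] 0) (𝓝 (∑ k ∈ Finset.Iic l, ((r k : ℝ) - Real.logb 2 (1 - 0)))) := by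
    refine Tendsto.mono_left (ContinuousAt.tendsto ?_) nhdsWithin_le_nhds
    simp only [Real.logb]
    fun_prop (disch := norm_num)
  have := ge_of_tendsto hlim (by
    filter_upwards [Ioo_mem_nhdsGT (show (0 : ℝ) < 1 by norm_num)] with δ hδ'
    exact hδ δ hδ'.1 hδ'.2)
  simpa using this

end Converse

/-! ### Random binning -/

section Hash

open scoped Classical in
/-- An exponential bound for the upper tail of a sum of iid letters. -/
theorem exists_tail_le_pow {Z : Type*} [Fintype Z] {p : Z → ℝ} (hp : ∀ z, 0 ≤ p z)
    (hp1 : ∑ z, p z = 1) (f : Z → ℝ) {μ : ℝ} (hμ : ∑ z, p z * f z < μ) :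
    ∃ ρ : ℝ, 0 ≤ ρ ∧ ρ < 1 ∧ ∀ n : ℕ,
      ∑ z : Fin n → Z with n * μ ≤ ∑ i, f (z i), ∏ i, p (z i) ≤ ρ ^ n := by
  set η := μ - ∑ z, p z * f z with hη
  have hη0 : 0 < η := sub_pos.2 hμ
  obtain ⟨K, hK⟩ : ∃ K, ∀ z, |f z - μ| ≤ K :=
    ⟨∑ z, |f z - μ|, fun z =>
      Finset.single_le_sum (f := fun z => |f z - μ|) (fun _ _ => abs_nonneg _) (Finset.mem_univ z)⟩
  set L := max K (max 1 η) with hL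
  have hL1 : 1 ≤ L := (le_max_left _ _).trans (le_max_right _ _)
  have hLη : η ≤ L := (le_max_right _ _).trans (le_max_right _ _)
  have hLK : ∀ z, |f z - μ| ≤ L := fun z => (hK z).trans (le_max_left _ _)
  -- This minimises `-s η + s² L²`; `η ≤ L` gives `s L ≤ 1`, the range where `exp x ≤ 1 + x + x²` is
  -- used.
  set s := η / (2 * L ^ 2) with hs
  have hs0 : 0 < s := by positivity
  have hsL : s * L ≤ 1 := by
    have : s * L = η / (2 * L) := by rw [hs]; field_simp
    rw [this, div_le_one (by positivity)]
    linarith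
  refine ⟨∑ z, p z * Real.exp (s * (f z - μ)),
    Finset.sum_nonneg fun z _ => mul_nonneg (hp z) (Real.exp_nonneg _), ?_, fun n => ?_⟩
  · calc ∑ z, p z * Real.exp (s * (f z - μ))
        ≤ ∑ z, p z * (1 + s * (f z - μ) + s ^ 2 * L ^ 2) := by
          refine Finset.sum_le_sum fun z _ => mul_le_mul_of_nonneg_left ?_ (hp z)
          have hb : |s * (f z - μ)| ≤ 1 := by
            rw [abs_mul, abs_of_pos hs0]
            exact (mul_le_mul_of_nonneg_left (hLK z) hs0.le).trans hsL
          have h1 := (abs_le.1 (Real.abs_exp_sub_one_sub_id_le hb)).2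
          have h2 : (f z - μ) ^ 2 ≤ L ^ 2 := sq_le_sq' (by linarith [(abs_le.1 (hLK z)).1])
            (abs_le.1 (hLK z)).2
          have h3 := mul_le_mul_of_nonneg_left h2 (sq_nonneg s)
          rw [mul_pow] at h1
          linarith
      _ = (∑ z, p z) * (1 - s * μ + s ^ 2 * L ^ 2) + s * ∑ z, p z * f z := by
          rw [Finset.sum_mul, Finset.mul_sum, ← Finset.sum_add_distrib]
          exact Finset.sum_congr rfl fun z _ => by ring
      _ = 1 - s * η + s ^ 2 * L ^ 2 := by rw [hp1, hη]; ring
      _ = 1 - s * η / 2 := by rw [hs]; field_simp; ring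
      _ < 1 := by linarith [mul_pos hs0 hη0]
  · calc ∑ z : Fin n → Z with n * μ ≤ ∑ i, f (z i), ∏ i, p (z i)
        ≤ ∑ z : Fin n → Z, ∏ i, (p (z i) * Real.exp (s * (f (z i) - μ))) := by
          rw [Finset.sum_filter]
          refine Finset.sum_le_sum fun z _ => ?_
          have hP : 0 ≤ ∏ i, p (z i) := Finset.prod_nonneg fun i _ => hp _
          rw [Finset.prod_mul_distrib, ← Real.exp_sum]
          split_ifs with h
          · refine le_mul_of_one_le_right hP (Real.one_le_exp ?_)
            rw [← Finset.mul_sum, Finset.sum_sub_distrib]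
            refine mul_nonneg hs0.le ?_
            simpa using h
          · exact mul_nonneg hP (Real.exp_nonneg _)
      _ = _ := by
          rw [sum_prod_pi (fun (_ : Fin n) z => p z * Real.exp (s * (f z - μ)))]
          simp

-- Overwriting `f a` by any value of `M` loses nothing, since the old value is still stored at `a'`.
-- So a uniformly random function collides at `a, a'` with probability at most `1 / card M`.
open scoped Classical in
theorem card_collision_mul_le {α M : Type*} [Fintype α] [Fintype M] {a a' : α} (h : a ≠ a') :
    (Finset.univ.filter fun f : α → M => f a = f a').card * Fintype.card M ≤
      Fintype.card (α → M) := by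
  rw [← Finset.card_univ (α := M), ← Finset.card_product, ← Finset.card_univ]
  refine Finset.card_le_card_of_injOn (fun x => Function.update x.1 a x.2) (by simp) ?_
  rintro ⟨f, v⟩ hf ⟨g, w⟩ hg hfg
  simp only [Finset.coe_product, Finset.coe_filter, Finset.mem_univ, true_and, Finset.coe_univ,
    Set.mem_prod, Set.mem_ofPred_eq, Set.mem_univ, and_true] at hf hg hfg
  have hv : v = w := by simpa using congrFun hfg a
  have ho : ∀ x, x ≠ a → f x = g x := fun x hx => by simpa [hx] using congrFun hfg x
  have hfg' : f = g := by
    funext x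
    by_cases hx : x = a
    · rw [hx, hf, hg]
      exact ho a' h.symm
    · exact ho x hx
  rw [hv, hfg']

open scoped Classical in
/-- Random binning: a hash function and decoders that search the bin for a candidate. -/
theorem exists_hash_of_card_le {X α M ι : Type*} {β : ι → Type*} [Fintype X] [Fintype α] [Fintype M]
    [Fintype ι] {P : X → ℝ} (hP : ∀ x, 0 ≤ P x) (hP1 : ∑ x, P x = 1) (A : X → α)
    (B : ∀ l, X → β l) (T : ∀ l, α → β l → Prop) (N : ℝ)
    (hN : ∀ l b, ((Finset.univ.filter fun a => T l a b).card : ℝ) ≤ N) [Nonempty M] :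
    ∃ h : α → M, ∃ D : ∀ l, M → β l → α,
      ∑ l, ∑ x with D l (h (A x)) (B l x) ≠ A x, P x ≤
        ∑ l : ι, (∑ x with ¬ T l (A x) (B l x), P x + N / Fintype.card M) := by
  have hM : (0 : ℝ) < Fintype.card M := by exact_mod_cast Fintype.card_pos
  have hX : Nonempty X := by
    by_contra h
    rw [not_nonempty_iff] at h
    simp at hP1
  have hα : Nonempty α := hX.map A
  let D : (α → M) → ∀ l, M → β l → α := fun h l v b => Classical.epsilon fun a => h a = v ∧ T l a b
  have hD : ∀ h l x, T l (A x) (B l x) → (∀ a, a ≠ A x → T l a (B l x) → h a ≠ h (A x)) →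
      D h l (h (A x)) (B l x) = A x := by
    intro h l x hT hne
    have hs : h (D h l (h (A x)) (B l x)) = h (A x) ∧ T l (D h l (h (A x)) (B l x)) (B l x) :=
      Classical.epsilon_spec (p := fun a => h a = h (A x) ∧ T l a (B l x)) ⟨A x, rfl, hT⟩
    by_contra hcon
    exact hne _ hcon hs.2 hs.1
  -- Some `h` is no worse than the average. Errors are already summed over `l`, so this one `h`
  -- suits all decoders.
  suffices hsum : ∑ h : α → M, ∑ l, ∑ x with D h l (h (A x)) (B l x) ≠ A x, P x ≤
      ∑ _h : α → M, ∑ l : ι, (∑ x with ¬ T l (A x) (B l x), P x + N / Fintype.card M) by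
    obtain ⟨h, -, hh⟩ := Finset.exists_le_of_sum_le Finset.univ_nonempty hsum
    exact ⟨h, D h, hh⟩
  -- An error means that the truth fails the test `T` or that a false candidate passing it shares
  -- the bin.
  have hpt : ∀ (h : α → M) l x, (if D h l (h (A x)) (B l x) ≠ A x then P x else 0) ≤
      (if ¬ T l (A x) (B l x) then P x else 0) +
        P x * ∑ a with T l a (B l x) ∧ a ≠ A x, if h a = h (A x) then 1 else 0 := by
    intro h l x
    have hs0 : (0 : ℝ) ≤ ∑ a with T l a (B l x) ∧ a ≠ A x, if h a = h (A x) then 1 else 0 :=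
      Finset.sum_nonneg fun a _ => by split_ifs <;> norm_num
    have hs1 := mul_nonneg (hP x) hs0
    by_cases hT : T l (A x) (B l x)
    · by_cases hc : ∀ a, a ≠ A x → T l a (B l x) → h a ≠ h (A x)
      · rw [if_neg (not_not.2 (hD h l x hT hc)), if_neg (not_not.2 hT), zero_add]
        exact hs1
      · push Not at hc
        obtain ⟨a, hne, hTa, hh⟩ := hc
        rw [if_neg (not_not.2 hT), zero_add]
        have h1 : (1 : ℝ) ≤ ∑ a with T l a (B l x) ∧ a ≠ A x, if h a = h (A x) then 1 else 0 := by
          refine le_trans (le_of_eq (if_pos hh).symm)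
            (Finset.single_le_sum (f := fun a => if h a = h (A x) then (1 : ℝ) else 0)
              (fun a _ => by split_ifs <;> norm_num) (by simp [hne, hTa]))
        have h2 := le_mul_of_one_le_right (hP x) h1
        split_ifs
        · exact h2
        · exact hs1
    · rw [if_pos hT]
      have := hP x
      split_ifs <;> linarith
  calc _ ≤ ∑ h : α → M, ∑ l, ∑ x, ((if ¬ T l (A x) (B l x) then P x else 0) +
        P x * ∑ a with T l a (B l x) ∧ a ≠ A x, if h a = h (A x) then 1 else 0) := by
        simp only [Finset.sum_filter (p := fun x => D _ _ _ _ ≠ A x)]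
        exact Finset.sum_le_sum fun h _ => Finset.sum_le_sum fun l _ =>
          Finset.sum_le_sum fun x _ => hpt h l x
    _ = ∑ l, ∑ x, ((Fintype.card (α → M) : ℝ) * (if ¬ T l (A x) (B l x) then P x else 0) +
        P x * ∑ a with T l a (B l x) ∧ a ≠ A x,
          ((Finset.univ.filter fun h : α → M => h a = h (A x)).card : ℝ)) := by
        rw [Finset.sum_comm]
        refine Finset.sum_congr rfl fun l _ => ?_
        rw [Finset.sum_comm]
        refine Finset.sum_congr rfl fun x _ => ?_
        rw [Finset.sum_add_distrib, Finset.sum_const, nsmul_eq_mul, Finset.card_univ,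
          ← Finset.mul_sum, Finset.sum_comm]
        simp
    _ ≤ ∑ l : ι, ∑ x, ((Fintype.card (α → M) : ℝ) * (if ¬ T l (A x) (B l x) then P x else 0) +
        P x * (Fintype.card (α → M) * (N / Fintype.card M))) := by
        refine Finset.sum_le_sum fun l _ => Finset.sum_le_sum fun x _ =>
          add_le_add_right (mul_le_mul_of_nonneg_left ?_ (hP x)) _
        calc ∑ a with T l a (B l x) ∧ a ≠ A x,
              ((Finset.univ.filter fun h : α → M => h a = h (A x)).card : ℝ)
            ≤ ∑ a with T l a (B l x) ∧ a ≠ A x,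
              ((Fintype.card (α → M) : ℝ) / Fintype.card M) := by
              refine Finset.sum_le_sum fun a ha => ?_
              rw [le_div_iff₀ hM]
              exact_mod_cast card_collision_mul_le (Finset.mem_filter.1 ha).2.2
          _ ≤ ∑ a with T l a (B l x), ((Fintype.card (α → M) : ℝ) / Fintype.card M) := by
              refine Finset.sum_le_sum_of_subset_of_nonneg ?_ fun _ _ _ => by positivity
              intro a
              simp +contextual
          _ ≤ N * ((Fintype.card (α → M) : ℝ) / Fintype.card M) := by
              rw [Finset.sum_const, nsmul_eq_mul]
              exact mul_le_mul_of_nonneg_right (hN l _) (by positivity)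
          _ = _ := by ring
    _ = _ := by
        rw [Finset.sum_const, nsmul_eq_mul, Finset.card_univ, Finset.mul_sum]
        refine Finset.sum_congr rfl fun l _ => ?_
        rw [Finset.sum_add_distrib, ← Finset.mul_sum, ← Finset.sum_mul, hP1, Finset.sum_filter]
        ring

-- The product probabilities sum to at most one, so fewer than `θ⁻¹` of them can exceed `θ`, up to
-- equality.
open scoped Classical in
theorem card_lt_prod_le_inv {α β : Type*} [Fintype α] {c : α → β → ℝ} (hc0 : ∀ a b, 0 ≤ c a b)
    (hc1 : ∀ b, ∑ a, c a b ≤ 1) {θ : ℝ} (hθ : 0 < θ) {n : ℕ} (y : Fin n → β) :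
    ((Finset.univ.filter fun a : Fin n → α => θ < ∏ i, c (a i) (y i)).card : ℝ) ≤ θ⁻¹ := by
  rw [← one_div, le_div_iff₀ hθ]
  calc _ = ∑ a : Fin n → α with θ < ∏ i, c (a i) (y i), θ := by
        rw [Finset.sum_const, nsmul_eq_mul]
    _ ≤ ∑ a : Fin n → α with θ < ∏ i, c (a i) (y i), ∏ i, c (a i) (y i) :=
        Finset.sum_le_sum fun a ha => (Finset.mem_filter.1 ha).2.le
    _ ≤ ∑ a : Fin n → α, ∏ i, c (a i) (y i) :=
        Finset.sum_le_sum_of_subset_of_nonneg (Finset.filter_subset _ _)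
          fun a _ _ => Finset.prod_nonneg fun i _ => hc0 _ _
    _ = ∏ i, ∑ a, c a (y i) := sum_prod_pi (fun i a => c a (y i))
    _ ≤ 1 := Finset.prod_le_one (fun i _ => Finset.sum_nonneg fun a _ => hc0 _ _)
        (fun i _ => hc1 _)

open scoped Classical in
open Filter in
/-- Slepian–Wolf coding of `A` with several decoders that have side-information `B_l`. -/
theorem eventually_exists_hash {Z α ι : Type*} {β : ι → Type*} [Fintype Z] [Fintype α] [Fintype ι]
    {p : Z → ℝ} (hp : ∀ z, 0 ≤ p z) (hp1 : ∑ z, p z = 1) (A : Z → α) (B : ∀ l, Z → β l)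
    (c : ∀ l, α → β l → ℝ) (hc0 : ∀ l a b, 0 ≤ c l a b) (hc1 : ∀ l b, ∑ a, c l a b ≤ 1)
    (hcp : ∀ l z, 0 < p z → 0 < c l (A z) (B l z)) {H : ℝ}
    (hH : ∀ l, ∑ z, p z * -Real.logb 2 (c l (A z) (B l z)) ≤ H) {ε : ℝ} (hε : 0 < ε) :
    ∀ᶠ n : ℕ in atTop, ∀ b : ℕ, n * (H + ε) ≤ b →
      ∃ h : (Fin n → α) → Fin b → Bool, ∃ D : ∀ l, (Fin b → Bool) → (Fin n → β l) → Fin n → α,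
        ∀ l, ∑ z : Fin n → Z with D l (h fun i => A (z i)) (fun i => B l (z i)) ≠ fun i => A (z i),
          ∏ i, p (z i) ≤ ε := by
  -- Half of `ε` goes to the typicality threshold; the other half makes the ratio of candidates to
  -- bins at most `2 ^ (-n ε / 2)`.
  choose ρ hρ0 hρ1 hρ using fun l => exists_tail_le_pow hp hp1
    (fun z => -Real.logb 2 (c l (A z) (B l z))) (μ := H + ε / 2) (by linarith [hH l])
  have hτ1 : (2 : ℝ) ^ (-(ε / 2)) < 1 := Real.rpow_lt_one_of_one_lt_of_neg one_lt_two (by linarith)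
  have hτ0 : (0 : ℝ) ≤ 2 ^ (-(ε / 2)) := by positivity
  have hlim : Tendsto (fun n : ℕ => ∑ l : ι, (ρ l ^ n + ((2 : ℝ) ^ (-(ε / 2))) ^ n)) atTop
      (nhds (∑ l : ι, (0 + 0))) :=
    tendsto_finsetSum _ fun l _ =>
      (tendsto_pow_atTop_nhds_zero_of_lt_one (hρ0 l) (hρ1 l)).add
        (tendsto_pow_atTop_nhds_zero_of_lt_one hτ0 hτ1)
  filter_upwards [hlim.eventually (eventually_le_nhds (b := ε) (by simpa using hε))] with n hn b hb
  have hP0 : ∀ z : Fin n → Z, 0 ≤ ∏ i, p (z i) := fun z => Finset.prod_nonneg fun i _ => hp _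
  obtain ⟨h, D, hD⟩ := exists_hash_of_card_le (M := Fin b → Bool) hP0
    (by rw [sum_prod_pi (fun (_ : Fin n) z => p z)]; simp [hp1])
    (fun z i => A (z i)) (fun l z i => B l (z i))
    (fun l a y => (2 : ℝ) ^ (-(n * (H + ε / 2))) < ∏ i, c l (a i) (y i))
    ((2 : ℝ) ^ (-(n * (H + ε / 2))))⁻¹
    (fun l y => card_lt_prod_le_inv (hc0 l) (hc1 l) (by positivity) y)
  have hle := hD.trans (Finset.sum_le_sum (g := fun l => ρ l ^ n + ((2 : ℝ) ^ (-(ε / 2))) ^ n)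
    fun l _ => add_le_add ?_ ?_)
  · refine ⟨h, D, fun l => le_trans ?_ (hle.trans hn)⟩
    have hsingle := Finset.single_le_sum (s := Finset.univ) (f := fun l =>
      ∑ z : Fin n → Z with D l (h fun i => A (z i)) (fun i => B l (z i)) ≠ fun i => A (z i),
        ∏ i, p (z i)) (fun l _ => Finset.sum_nonneg fun z _ => hP0 z) (Finset.mem_univ l)
    convert hsingle
  · refine le_trans ?_ (hρ l n)
    rw [Finset.sum_filter, Finset.sum_filter]
    refine Finset.sum_le_sum fun z _ => ?_
    rcases (hP0 z).eq_or_lt with hz | hz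
    · rw [← hz]; simp
    · have hzi : ∀ i, 0 < c l (A (z i)) (B l (z i)) := fun i => hcp l _
        ((hp _).lt_of_ne' fun h => hz.ne' (Finset.prod_eq_zero (Finset.mem_univ i) h))
      by_cases hT : (2 : ℝ) ^ (-(n * (H + ε / 2))) < ∏ i, c l (A (z i)) (B l (z i))
      · rw [if_neg (not_not.2 hT)]
        split_ifs
        · exact hz.le
        · exact le_rfl
      · rw [if_pos hT, if_pos]
        have h1 := (Real.logb_le_logb one_lt_two (Finset.prod_pos fun i _ => hzi i)
          (by positivity)).2 (not_lt.1 hT)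
        rw [Real.logb_prod _ _ fun i _ => (hzi i).ne', Real.logb_rpow two_pos (by norm_num)] at h1
        rw [Finset.sum_neg_distrib]
        linarith
  · rw [Fintype.card_fun, Fintype.card_bool, Fintype.card_fin, ← Real.rpow_natCast,
      ← Real.rpow_mul two_pos.le]
    push_cast
    rw [← Real.rpow_natCast, ← Real.rpow_neg two_pos.le, ← Real.rpow_sub two_pos]
    refine Real.rpow_le_rpow_of_exponent_le one_le_two ?_
    linarith

end Hash

/-! ### Distributing the bits over the messages -/

theorem finSigmaFinEquiv_val_eq {t : ℕ} {b : Fin t → ℕ} (x : (k : Fin t) × Fin (b k)) :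
    (finSigmaFinEquiv x : ℕ) = ∑ j ∈ Finset.Iio x.1, b j + x.2 := by
  rw [finSigmaFinEquiv_apply]
  congr 1
  refine Finset.sum_bij (fun i _ => Fin.castLE x.1.2.le i) ?_ ?_ ?_ ?_
  · intro i _
    simp [Fin.lt_def]
  · intro i _ j _ h
    simpa using h
  · intro j hj
    exact ⟨⟨j, Fin.lt_def.1 (Finset.mem_Iio.1 hj)⟩, Finset.mem_univ _, rfl⟩
  · intro i _
    rfl

/-- If the partial sums of `b` are at most those of `m`, then the `b k` bits of each block `k` can
be stored in the blocks up to `k`, each block `l` having room for `m l` bits. -/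
theorem exists_injective_sigma {t : ℕ} {b m : Fin t → ℕ}
    (hbm : ∀ k, ∑ j ∈ Finset.Iic k, b j ≤ ∑ j ∈ Finset.Iic k, m j) :
    ∃ φ : ((k : Fin t) × Fin (b k)) → (k : Fin t) × Fin (m k),
      Function.Injective φ ∧ ∀ x, (φ x).1 ≤ x.1 := by
  have htot : ∑ k, b k ≤ ∑ k, m k := by
    cases t with
    | zero => simp
    | succ t =>
      have h := hbm (Fin.last t)
      rwa [show Finset.Iic (Fin.last t) = Finset.univ from by ext; simp [Fin.le_last]] at h
  -- All blocks are concatenated and the string is cut again at the boundaries given by `m`. A bit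
  -- of block `k` sits before position `∑_{j ≤ k} b j ≤ ∑_{j ≤ k} m j`, so it lands in a block up to
  -- `k`.
  refine ⟨fun x => finSigmaFinEquiv.symm (Fin.castLE htot (finSigmaFinEquiv x)),
    fun x y h => by simpa using h, fun x => ?_⟩
  set y := finSigmaFinEquiv.symm (Fin.castLE htot (finSigmaFinEquiv x)) with hy
  have hxy : (finSigmaFinEquiv y : ℕ) = (finSigmaFinEquiv x : ℕ) := by simp [hy]
  rw [finSigmaFinEquiv_val_eq, finSigmaFinEquiv_val_eq] at hxy
  by_contra hlt
  rw [not_le] at hlt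
  have h1 : ∑ j ∈ Finset.Iic x.1, m j ≤ ∑ j ∈ Finset.Iio y.1, m j :=
    Finset.sum_le_sum_of_subset fun j hj =>
      Finset.mem_Iio.2 ((Finset.mem_Iic.1 hj).trans_lt hlt)
  have h2 := hbm x.1
  rw [← Finset.Iio_insert, Finset.sum_insert (by simp), Finset.sum_insert (by simp)] at h2
  rw [← Finset.Iio_insert, Finset.sum_insert (by simp)] at h1
  have := x.2.isLt
  omega

/-! ### Achievability: assembling the code -/

section Achievability

variable {t : ℕ} {W Y : Fin t → Type*}

/-- Hash functions for the messages, together with decoders that use the preceding messages as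
additional side-information, give a code. -/
theorem exists_code_of_hash {n : ℕ} [∀ k, Nonempty (W k)] {b m : Fin t → ℕ}
    (hbm : ∀ k, ∑ j ∈ Finset.Iic k, b j ≤ ∑ j ∈ Finset.Iic k, m j)
    (h : ∀ k, (Fin n → W k) → Fin (b k) → Bool)
    (D : ∀ k, ∀ l : {l : Fin t // k ≤ l}, (Fin (b k) → Bool) →
      (Fin n → (∀ j : {j : Fin t // j < k}, W j) × Y l) → Fin n → W k) :
    ∃ c : Code (∀ l, W l) Y W n, (∀ l, c.size l = 2 ^ m l) ∧
      ∀ l (z : Fin n → (∀ l, W l) × ∀ l, Y l),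
        (∀ k (hk : k ≤ l), D k ⟨l, hk⟩ (h k fun i => (z i).1 k)
          (fun i => ((fun j : {j : Fin t // j < k} => (z i).1 j), (z i).2 l)) =
            fun i => (z i).1 k) →
        c.replica l z = fun i => (z i).1 l := by
  obtain ⟨φ, hφ, hle⟩ := exists_injective_sigma hbm
  let e : ∀ m : ℕ, (Fin m → Bool) ≃ Fin (2 ^ m) := fun m => Fintype.equivFinOfCardEq (by simp)
  let bits : (Fin n → ∀ l, W l) → ((k : Fin t) × Fin (b k)) → Bool :=
    fun x y => h y.1 (fun i => x i y.1) y.2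
  let unhash : ∀ l : Fin t, (∀ k : {k : Fin t // k ≤ l}, Fin (2 ^ m k)) →
      ∀ k, k ≤ l → Fin (b k) → Bool := fun l msg k hk i =>
    (e _).symm (msg ⟨(φ ⟨k, i⟩).1, (hle ⟨k, i⟩).trans hk⟩) (φ ⟨k, i⟩).2
  -- Successive decoding stated as a consistency condition: the decoder picks any source sequence
  -- that all stages `k ≤ l` reproduce, avoiding a recursive definition.
  let good : ∀ l : Fin t, (∀ k : {k : Fin t // k ≤ l}, Fin (2 ^ m k)) → (Fin n → Y l) →
      (Fin n → ∀ k, W k) → Prop := fun l msg y w => ∀ k (hk : k ≤ l),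
    D k ⟨l, hk⟩ (unhash l msg k hk)
      (fun i => ((fun j : {j : Fin t // j < k} => w i j), y i)) = fun i => w i k
  let c : Code (∀ l, W l) Y W n :=
    { size := fun l => 2 ^ m l
      enc := fun x l => e (m l) fun s => Function.extend φ (bits x) (fun _ => false) ⟨l, s⟩
      dec := fun l msg y i => Classical.epsilon (good l msg y) i l }
  refine ⟨c, fun _ => rfl, fun l z hz => ?_⟩
  have hun : ∀ k (hk : k ≤ l),
      unhash l (fun k : {k : Fin t // k ≤ l} => c.enc (fun i => (z i).1) k) k hk =
        h k fun i => (z i).1 k := by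
    intro k hk
    funext i
    simp only [unhash, c, Equiv.symm_apply_apply]
    exact hφ.extend_apply (bits fun i => (z i).1) (fun _ => false) ⟨k, i⟩
  have hgood : good l (fun k : {k : Fin t // k ≤ l} => c.enc (fun i => (z i).1) k)
      (fun i => (z i).2 l) (fun i => (z i).1) := by
    intro k hk
    rw [hun k hk]
    exact hz k hk
  have heps := Classical.epsilon_spec ⟨_, hgood⟩
  set w := Classical.epsilon (good l (fun k : {k : Fin t // k ≤ l} => c.enc (fun i => (z i).1) k)
      (fun i => (z i).2 l)) with hw
  -- Consistency forces uniqueness: once the components below `k` are right, stage `k` sees the true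
  -- side-information and returns the true `W_k`.
  have hwz : ∀ k, k ≤ l → ∀ i, w i k = (z i).1 k := by
    intro k
    induction k using WellFoundedLT.induction with
    | ind k ih =>
      intro hk i
      have h1 := heps k hk
      rw [hun k hk] at h1
      have h2 : (fun i => ((fun j : {j : Fin t // j < k} => w i j), (z i).2 l)) =
          fun i => ((fun j : {j : Fin t // j < k} => (z i).1 j), (z i).2 l) := by
        funext i
        refine Prod.ext (funext fun j => ?_) rfl
        exact ih j j.2 (j.2.le.trans hk) i
      rw [h2, hz k hk] at h1
      exact (congrFun h1 i).symm
  funext i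
  exact hwz l le_rfl i

variable [∀ l, Fintype (W l)] [∀ l, Fintype (Y l)] {q : PMF ((∀ l, W l) × ∀ l, Y l)}

theorem condEntropy_nonneg {Z α β : Type*} [Fintype Z] [Fintype α] [Fintype β] (q : PMF Z)
    (A : Z → α) (B : Z → β) : 0 ≤ condEntropy q A B := by
  have hp : ∀ z, 0 ≤ (q z).toReal := fun z => ENNReal.toReal_nonneg
  rw [condEntropy_eq_sum]
  exact Finset.sum_nonneg fun z _ => mul_nonneg (hp z) (neg_nonneg.2
    (Real.logb_nonpos one_lt_two (cond_nonneg hp _ _ _ _) (cond_le_one hp _ _ _ _)))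

/-- Better side-information does not increase the conditional entropy. -/
theorem IsDegraded.condEntropy_le (hq : IsDegraded q) {k l : Fin t} (hkl : k ≤ l) :
    condEntropy q (fun z => z.1 k) (fun z => ((fun j : {j : Fin t // j < k} => z.1 j), z.2 l)) ≤
      condEntropy q (fun z => z.1 k)
        (fun z => ((fun j : {j : Fin t // j < k} => z.1 j), z.2 k)) := by
  rcases hkl.eq_or_lt with rfl | hlt
  · exact le_rfl
  · exact (hq l).condEntropy_le (fun a => a.1 k) (fun a => fun j : {j : Fin t // j < k} => a.1 j)
      (fun y => y ⟨k, hlt⟩)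

-- A block without error contributes nothing, and any other block has symbol error fraction at most
-- one.
open scoped Classical in
theorem Code.distortion_le {n : ℕ} (hn : 0 < n) (c : Code (∀ l, W l) Y W n) (l : Fin t) :
    c.distortion q (privateDistortion W) l ≤
      ∑ z : Fin n → (∀ l, W l) × ∀ l, Y l with c.replica l z ≠ fun i => (z i).1 l,
        ∏ i, (q (z i)).toReal := by
  have hn' : (0 : ℝ) < n := by exact_mod_cast hn
  rw [Code.distortion, Finset.sum_filter]
  refine Finset.sum_le_sum fun z _ => ?_
  have hP : 0 ≤ ∏ i, (q (z i)).toReal := Finset.prod_nonneg fun i _ => ENNReal.toReal_nonneg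
  split_ifs with h
  · refine mul_le_of_le_one_right hP ?_
    rw [one_div, inv_mul_le_iff₀ hn', mul_one]
    refine (Finset.sum_le_card_nsmul _ _ (1 : ℝ) fun i _ => ?_).trans (by simp)
    unfold privateDistortion
    split_ifs <;> simp
  · rw [not_not] at h
    simp [h, privateDistortion]

open Filter in
theorem IsDegraded.mem_rateRegion (hq : IsDegraded q) {r : Fin t → ℝ≥0}
    (hr : ∀ l : Fin t, ∑ k ∈ Finset.Iic l, condEntropy q (fun z => z.1 k)
        (fun z => ((fun j : {j : Fin t // j < k} => z.1 j), z.2 k)) ≤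
      ∑ k ∈ Finset.Iic l, (r k : ℝ)) :
    r ∈ rateRegion q (privateDistortion W) 0 := by
  classical
  intro ε hε
  have hp : ∀ z, 0 ≤ (q z).toReal := fun z => ENNReal.toReal_nonneg
  obtain ⟨z₀, -⟩ := q.support_nonempty
  have hW : ∀ k, Nonempty (W k) := fun k => ⟨z₀.1 k⟩
  set H : Fin t → ℝ := fun k => condEntropy q (fun z => z.1 k)
    (fun z => ((fun j : {j : Fin t // j < k} => z.1 j), z.2 k)) with hHdef
  have hH0 : ∀ k, 0 ≤ H k := fun k => condEntropy_nonneg _ _ _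
  -- Small enough that at most `t` stage errors total at most `ε`, and `ε' ≤ ε / 2`. With `n ε ≥ 4`
  -- the remaining slack `n ε / 2 ≥ 2` absorbs rounding `b` up and `m` down.
  set ε' := ε / (2 * (t + 1)) with hε'
  have ht : (0 : ℝ) ≤ t := t.cast_nonneg
  have hε'0 : 0 < ε' := by positivity
  have hε't : t * ε' ≤ ε := by
    rw [hε', mul_div_assoc', div_le_iff₀ (by positivity)]
    nlinarith
  have hε'2 : ε' ≤ ε / 2 := by
    rw [hε']
    exact div_le_div_of_nonneg_left hε.le (by norm_num) (by linarith)
  have hev := eventually_all.2 fun k : Fin t =>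
    eventually_exists_hash (β := fun l : {l : Fin t // k ≤ l} =>
        (∀ j : {j : Fin t // j < k}, W j) × Y l) hp (sum_toReal_eq_one q)
      (fun z => z.1 k) (fun l z => ((fun j : {j : Fin t // j < k} => z.1 j), z.2 l))
      (fun l => cond (fun z => (q z).toReal) (fun z => z.1 k)
        (fun z => ((fun j : {j : Fin t // j < k} => z.1 j), z.2 l)))
      (fun l => cond_nonneg hp _ _) (fun l => sum_cond_le_one _ _ _)
      (fun l z hz => cond_pos hp (fun z => z.1 k)
        (fun z => ((fun j : {j : Fin t // j < k} => z.1 j), z.2 l)) hz)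
      (H := H k) (fun l => by
        have h1 := hq.condEntropy_le l.2
        rwa [condEntropy_eq_sum] at h1) hε'0
  obtain ⟨n, ⟨hn, hnε⟩, hn0⟩ := ((hev.and (tendsto_natCast_atTop_atTop.eventually_ge_atTop
    (4 / ε : ℝ))).and (eventually_gt_atTop 0)).exists
  have hn' : (0 : ℝ) < n := by exact_mod_cast hn0
  rw [div_le_iff₀ hε] at hnε
  set b : Fin t → ℕ := fun k => ⌈n * (H k + ε')⌉₊ with hb
  set m : Fin t → ℕ := fun k => ⌊n * ((r k : ℝ) + ε)⌋₊ with hm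
  have hm0 : ∀ k, 0 ≤ n * ((r k : ℝ) + ε) := fun k => by positivity
  have hbm : ∀ k, ∑ j ∈ Finset.Iic k, b j ≤ ∑ j ∈ Finset.Iic k, m j := by
    intro k
    have h1 : ∀ j, (b j : ℝ) ≤ n * H j + (n * ε' + 1) := fun j => by
      have := (Nat.ceil_lt_add_one (mul_nonneg hn'.le (add_nonneg (hH0 j) hε'0.le))).le
      rw [mul_add] at this
      simp only [hb]
      rw [mul_add]
      linarith
    have h2 : ∀ j, n * (r j : ℝ) + (n * ε - 1) ≤ m j := fun j => by
      have := (Nat.lt_floor_add_one (n * ((r j : ℝ) + ε))).le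
      simp only [hm]
      rw [mul_add] at this ⊢
      linarith
    have h3 : n * ε' + 1 ≤ n * ε - 1 := by
      have := mul_le_mul_of_nonneg_left hε'2 hn'.le
      linarith
    have h4 : (∑ j ∈ Finset.Iic k, (b j : ℝ)) ≤ ∑ j ∈ Finset.Iic k, (m j : ℝ) := by
      calc (∑ j ∈ Finset.Iic k, (b j : ℝ))
          ≤ ∑ j ∈ Finset.Iic k, (n * H j + (n * ε - 1)) :=
            Finset.sum_le_sum fun j _ => (h1 j).trans (by linarith)
        _ ≤ ∑ j ∈ Finset.Iic k, (n * (r j : ℝ) + (n * ε - 1)) := by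
            rw [Finset.sum_add_distrib, Finset.sum_add_distrib, ← Finset.mul_sum, ← Finset.mul_sum]
            have := mul_le_mul_of_nonneg_left (hr k) hn'.le
            linarith
        _ ≤ _ := Finset.sum_le_sum fun j _ => h2 j
    exact_mod_cast h4
  choose h D hD using fun k => hn k (b k) (Nat.le_ceil _)
  obtain ⟨c, hsize, hc⟩ := exists_code_of_hash hbm h D
  refine ⟨n, hn0, c, fun l => ?_, fun l => ?_⟩
  · simp only [Pi.zero_apply, NNReal.coe_zero, zero_add]
    refine (c.distortion_le hn0 l).trans (le_trans ?_ hε't)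
    -- Union bound: decoder `l` errs only if some stage `k ≤ l`, given the true earlier components,
    -- errs.
    calc _ ≤ ∑ k : {k : Fin t // k ≤ l}, ∑ z : Fin n → (∀ l, W l) × ∀ l, Y l with
          D k ⟨l, k.2⟩ (h k fun i => (z i).1 k)
            (fun i => ((fun j : {j : Fin t // j < k.1} => (z i).1 j), (z i).2 l)) ≠
            fun i => (z i).1 k, ∏ i, (q (z i)).toReal := by
          simp only [Finset.sum_filter]
          rw [Finset.sum_comm]
          refine Finset.sum_le_sum fun z _ => ?_
          have hP : 0 ≤ ∏ i, (q (z i)).toReal := Finset.prod_nonneg fun i _ => hp _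
          split_ifs with hz
          · have hex : ∃ k : {k : Fin t // k ≤ l}, D k ⟨l, k.2⟩ (h k fun i => (z i).1 k)
                (fun i => ((fun j : {j : Fin t // j < k.1} => (z i).1 j), (z i).2 l)) ≠
                fun i => (z i).1 k := by
              by_contra hall
              push Not at hall
              exact hz (hc l z fun k hk => hall ⟨k, hk⟩)
            obtain ⟨k, hk⟩ := hex
            refine le_trans (le_of_eq (if_pos hk).symm)
              (Finset.single_le_sum (f := fun k : {k : Fin t // k ≤ l} =>
                if D k ⟨l, k.2⟩ (h k fun i => (z i).1 k)
                (fun i => ((fun j : {j : Fin t // j < k.1} => (z i).1 j), (z i).2 l)) ≠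
                fun i => (z i).1 k then ∏ i, (q (z i)).toReal else 0) ?_ (Finset.mem_univ k))
            intro k _
            dsimp only
            split_ifs
            · exact hP
            · exact le_rfl
          · exact Finset.sum_nonneg fun k _ => by
              split_ifs
              · exact hP
              · exact le_rfl
      _ ≤ ∑ k : {k : Fin t // k ≤ l}, ε' := Finset.sum_le_sum fun k _ => by
          convert hD k ⟨l, k.2⟩
      _ ≤ t * ε' := by
          rw [Finset.sum_const, nsmul_eq_mul, Finset.card_univ]
          refine mul_le_mul_of_nonneg_right ?_ hε'0.le
          exact_mod_cast (Fintype.card_subtype_le _).trans (by simp)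
  · rw [Code.rate, hsize, Nat.cast_pow, Nat.cast_ofNat, Real.logb_pow,
      Real.logb_self_eq_one one_lt_two, mul_one, one_div, inv_mul_le_iff₀ hn']
    exact Nat.floor_le (hm0 l)

end Achievability

end SuccRef

theorem theorem3 {t : ℕ} (W Y : Fin t → Type*) [∀ l, Fintype (W l)] [∀ l, Fintype (Y l)]
    (q : PMF ((∀ l, W l) × ∀ l, Y l)) (hq : SuccRef.IsDegraded q) :
    SuccRef.rateRegion q (SuccRef.privateDistortion W) 0 =
      {r : Fin t → ℝ≥0 | ∀ l : Fin t,
        ∑ k ∈ Finset.Iic l,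
            SuccRef.condEntropy q (fun z => z.1 k)
              (fun z => ((fun j : {j : Fin t // j < k} => z.1 j), z.2 k))
          ≤ ∑ k ∈ Finset.Iic l, (r k : ℝ)} :=
  Set.ext fun _ => ⟨fun hr l => hq.rateRegion_subset hr l, fun hr => hq.mem_rateRegion hr⟩
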